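/- A digraph $(G,\to)$ is a set $G$ with a binary relation $\to$ on it; it is well-founded if $\to$ is a well-founded relation. For an ordinal $\lambda$, the digraph is $\lambda$-graded if every vertex $a$ is assigned an ordinal value $q_a<\lambda$ so that $a\to b$ implies $q_a<q_b$. Here $V_\alpha$ and $L_\alpha$ denote the levels of the von Neumann hierarchy and of the constructible hierarchy ($L_0=\emptyset$; $L_{\alpha+1}$ is the set of all subsets of $L_\alpha$ that are first-order definable with parameters in $(L_\alpha,\in)$; unions at limits). **Lemma.** Let $(G,\to)$ be a well-founded digraph. Then $(G,\to)$ is isomorphic to $(A,\in)$ for some set $A$. In fact (the vertices being sets), there is exactly one function $\pi$ on $G$ with $$\pi(x)=\{\pi(y) : y\to x\}\cup\{\{\emptyset,x\}\}\qquad\text{for all }x\in G,$$ and it is an isomorphism of $(G,\to)$ onto $(A,\in)$, where $A=\{\pi(x): x\in G\}$. Furthermore: 1. If $G$ is finite, then $(G,\to)\cong(A,\in)$ for some hereditarily finite set $A$. 2. If $G$ is countable and $\lambda$-graded for some ordinal $\lambda$, then $(G,\to)\cong(A,\in)$ for some $A\subseteq V_{\omega+\lambda}$. In particular, if $\omega^2\le\lambda$,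 then there is such an $A\subseteq V_\lambda$. 3. If $G$ is $\lambda$-graded and $|G|\le|V_\beta|$ for ordinals $\lambda,\beta$, then $(G,\to)\cong(A,\in)$ for some $A\subseteq V_{\beta+2+\lambda}$. In particular, if $\lambda$ is infinite and $\beta^2\le\lambda$, then there is such an $A\subseteq V_\lambda$. 4. If $G$ is countable and $\lambda$-graded, with $\lambda$ infinite, then $(G,\to)\cong(A,\in)$ for some $A\subseteq L_{\lambda+\lambda}$. -/

import Mathlib

open scoped ZFSet

universe u v

/-- A digraph is `ℓ`-graded, for a linear order `ℓ`, if its vertices can be assigned values in `ℓ`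
that strictly increase along every edge. For an ordinal `lam`, "`lam`-graded" is the case
`ℓ = Set.Iio lam`, the set of ordinals below `lam`. -/
def Digraph.IsGraded {G : Type v} (D : Digraph G) (ℓ : Type*) [LinearOrder ℓ] : Prop :=
  ∃ q : G → ℓ, ∀ a b : G, D.Adj a b → q a < q b

/-- `(G, →)` is isomorphic to `(A, ∈)`. -/
def Digraph.IsoToMem {G : Type v} (D : Digraph G) (A : ZFSet.{u}) : Prop :=
  Nonempty (D.Adj ≃r (fun a b : A => (a : ZFSet.{u}) ∈ (b : ZFSet.{u})))

/-- `π` satisfies the recursion `π(x) = {π(y) : y → x} ∪ {{∅, x}}` of the modified Mostowski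
collapse, the node `x` being regarded as the set `e x`. -/
def Digraph.IsModifiedCollapse {G : Type v} [Small.{u} G] (D : Digraph G)
    (e π : G → ZFSet.{u}) : Prop :=
  ∀ x : G, π x = ZFSet.range (fun y : {y : G // D.Adj y x} => π y) ∪ {{∅, e x}}

/-- `x` is hereditarily finite: `x`, its elements, their elements, and so on are all finite. -/
def ZFSet.IsHereditarilyFinite (x : ZFSet.{u}) : Prop :=
  x.Hereditarily fun y => {z : ZFSet.{u} | z ∈ y}.Finite

/-- The relation symbols of the language of set theory: a single binary symbol. -/
inductive SetTheoryRel : ℕ → Type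
  | mem : SetTheoryRel 2

/-- The first-order language of set theory. -/
def setTheoryLanguage : FirstOrder.Language :=
  ⟨fun _ => Empty, SetTheoryRel⟩

/-- The structure `(A, ∈)`. -/
instance ZFSet.memStructure (A : ZFSet.{u}) : setTheoryLanguage.Structure A where
  funMap f := nomatch f
  RelMap
    | .mem => fun x => (x 0 : ZFSet.{u}) ∈ (x 1 : ZFSet.{u})

/-- The set of all subsets of `A` that are first-order definable, with parameters from `A`, in
the structure `(A, ∈)`. -/
noncomputable def ZFSet.definablePowerset (A : ZFSet.{u}) : ZFSet.{u} :=
  ZFSet.sep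
    (fun X => (Set.univ : Set A).Definable₁ setTheoryLanguage {a : A | (a : ZFSet.{u}) ∈ X})
    (ZFSet.powerset A)

/-- The constructible hierarchy: `L_0 = ∅`, `L_{α+1}` is the definable power set of `L_α`, and
`L_α` is the union of the `L_β`, `β < α`, for limit `α`. -/
noncomputable def ZFSet.constructible (o : Ordinal.{u}) : ZFSet.{u} :=
  Ordinal.limitRecOn o ∅ (fun _ A => ZFSet.definablePowerset A)
    (fun α _ f => ZFSet.iUnion fun b : Set.Iio α => f b.1 b.2)

theorem ZFSet.constructible_zero : ZFSet.constructible.{u} 0 = ∅ :=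
  Ordinal.limitRecOn_zero _ _ _

theorem ZFSet.constructible_add_one (o : Ordinal.{u}) :
    ZFSet.constructible (o + 1) = ZFSet.definablePowerset (ZFSet.constructible o) :=
  Ordinal.limitRecOn_add_one _ _ _ _

theorem ZFSet.constructible_limit (o : Ordinal.{u}) (ho : Order.IsSuccLimit o) :
    ZFSet.constructible o = ZFSet.iUnion fun b : Set.Iio o => ZFSet.constructible b.1 :=
  Ordinal.limitRecOn_limit _ _ _ _ ho

/-! An ordinary Mostowski collapse identifies vertices with the same predecessors. The marker `{∅, e
x}` prevents this: it contains `∅`, whereas no `π y` does, so markers and collapse values never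
coincide and each `π x` determines its own marker, hence `x`. Clauses 1–3 are choices of the
injection `e`. By `rank_le` the collapse has rank at most `κ + q x` once all markers have rank below
`κ`; iterated singletons give `κ = ω`, elements of `V_ β` give `κ = β + 2`.

Clause 4 needs another construction, since `{π y : y → x}` need not be definable. Only membership
between nodes matters, so a node may have irrelevant elements. Enumerate `G` by `f`. Each edge is
recorded in finite data attached to its later endpoint: the tag of `x` lists the earlier targets of
`x`, and `earlierTags` lists the tags of its earlier sources. The node of `x` collects, by one
formula with these finite sets as parameters, every set in `L_(ω + q x)` whose tag indicates an edge
to `x`. -/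

namespace Digraph

variable {G : Type v} {D : Digraph G}

/-- An injective family of sets whose membership relation is that of the digraph realizes it. -/
theorem exists_relIso_range [Small.{u} G] {a : G → ZFSet.{u}} (ha : Function.Injective a)
    (h : ∀ x y, a x ∈ a y ↔ D.Adj x y) :
    ∃ φ : D.Adj ≃r (fun b c : ZFSet.range a => (b : ZFSet.{u}) ∈ (c : ZFSet.{u})),
      ∀ x : G, (φ x : ZFSet.{u}) = a x := by
  let g : G → ZFSet.range a := fun x => ⟨a x, ZFSet.mem_range_self x⟩
  have hg : Function.Bijective g := by
    refine ⟨fun x y hxy => ha (congrArg Subtype.val hxy), fun ⟨z, hz⟩ => ?_⟩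
    obtain ⟨x, rfl⟩ := ZFSet.mem_range.1 hz
    exact ⟨x, rfl⟩
  exact ⟨⟨Equiv.ofBijective g hg, fun {x y} => h x y⟩, fun _ => rfl⟩

theorem isoToMem_range [Small.{u} G] {a : G → ZFSet.{u}} (ha : Function.Injective a)
    (h : ∀ x y, a x ∈ a y ↔ D.Adj x y) : D.IsoToMem (ZFSet.range a) :=
  let ⟨φ, _⟩ := exists_relIso_range ha h
  ⟨φ⟩

/-! ### The modified Mostowski collapse and its rank -/

theorem existsUnique_isModifiedCollapse [Small.{u} G] (hD : WellFounded D.Adj)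
    (e : G → ZFSet.{u}) : ∃! π : G → ZFSet.{u}, D.IsModifiedCollapse e π := by
  refine ⟨hD.fix fun x π => ZFSet.range (fun y : {y : G // D.Adj y x} => π y.1 y.2) ∪ {{∅, e x}},
    fun x => hD.fix_eq _ x, fun π hπ => funext fun x => ?_⟩
  induction x using hD.induction with
  | _ x ih =>
    rw [hπ x, hD.fix_eq]
    congr 2
    exact funext fun y => ih y.1 y.2

namespace IsModifiedCollapse

variable [Small.{u} G] {e π : G → ZFSet.{u}}

theorem mem_iff (h : D.IsModifiedCollapse e π) {z : ZFSet.{u}} {x : G} :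
    z ∈ π x ↔ (∃ y, D.Adj y x ∧ π y = z) ∨ z = {∅, e x} := by
  rw [h x]
  simp

/-- Each `π y` contains its own marker and so is nonempty, and a marker is nonempty too. -/
theorem empty_notMem (h : D.IsModifiedCollapse e π) (x : G) : ∅ ∉ π x := by
  have hne (y : G) (z : ZFSet.{u}) : z ∈ π y → π y ≠ ∅ := fun hz h0 => by simp [h0] at hz
  rw [h.mem_iff]
  rintro (⟨y, -, hy⟩ | hx)
  · exact hne y _ (h.mem_iff.2 (.inr rfl)) hy
  · exact (ZFSet.eq_empty _).1 hx.symm ∅ (ZFSet.mem_insert _ _)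

theorem ne_pair (h : D.IsModifiedCollapse e π) (x y : G) : π x ≠ {∅, e y} := fun hxy =>
  h.empty_notMem x (hxy ▸ ZFSet.mem_insert _ _)

/-- The marker of `x` lies in `π y` but is not a collapse value, so it is the marker of `y`; an
unordered pair with `∅` determines its other entry. -/
theorem injective (h : D.IsModifiedCollapse e π) (he : Function.Injective e) :
    Function.Injective π := by
  intro x y hxy
  have hx : {∅, e x} ∈ π y := hxy ▸ h.mem_iff.2 (.inr rfl)
  obtain ⟨z, -, hz⟩ | hx := h.mem_iff.1 hx
  · exact (h.ne_pair _ _ hz).elim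
  · have h1 : e x ∈ ({∅, e y} : ZFSet) := hx ▸ by simp
    have h2 : e y ∈ ({∅, e x} : ZFSet) := hx ▸ by simp
    simp only [ZFSet.mem_pair] at h1 h2
    apply he
    obtain h1 | h1 := h1
    · obtain h2 | h2 := h2
      · rw [h1, h2]
      · exact h2.symm
    · exact h1

theorem mem_iff_adj (h : D.IsModifiedCollapse e π) (he : Function.Injective e) (x y : G) :
    π x ∈ π y ↔ D.Adj x y := by
  rw [h.mem_iff]
  constructor
  · rintro (⟨z, hz, hzx⟩ | hx)
    · exact h.injective he hzx ▸ hz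
    · exact (h.ne_pair _ _ hx).elim
  · exact fun hxy => .inl ⟨x, hxy, rfl⟩

theorem isoToMem (h : D.IsModifiedCollapse e π) (he : Function.Injective e) :
    D.IsoToMem (ZFSet.range π) :=
  isoToMem_range (h.injective he) (h.mem_iff_adj he)

theorem rank_le (h : D.IsModifiedCollapse e π) (hD : WellFounded D.Adj) {κ : Ordinal.{u}}
    (he : ∀ x, ZFSet.rank {∅, e x} < κ) {q : G → Ordinal.{u}}
    (hq : ∀ x y, D.Adj x y → q x < q y) (x : G) : (π x).rank ≤ κ + q x := by
  induction x using hD.induction with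
  | _ x ih =>
    rw [ZFSet.rank_le_iff]
    intro z hz
    obtain ⟨y, hy, rfl⟩ | rfl := h.mem_iff.1 hz
    · exact (ih y hy).trans_lt (by gcongr; exact hq y x hy)
    · exact (he x).trans_le le_self_add

end IsModifiedCollapse

theorem exists_subset_vonNeumann [Small.{u} G] (hD : WellFounded D.Adj) {κ lam : Ordinal.{u}}
    {e : G → ZFSet.{u}} (hinj : Function.Injective e) (he : ∀ x, ZFSet.rank {∅, e x} < κ)
    (hq : D.IsGraded (Set.Iio lam)) : ∃ A : ZFSet.{u}, A ⊆ V_ (κ + lam) ∧ D.IsoToMem A := by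
  obtain ⟨π, hπ, -⟩ := existsUnique_isModifiedCollapse hD e
  obtain ⟨q, hq⟩ := hq
  refine ⟨ZFSet.range π, fun z hz => ?_, hπ.isoToMem hinj⟩
  obtain ⟨x, rfl⟩ := ZFSet.mem_range.1 hz
  rw [ZFSet.mem_vonNeumann]
  refine (hπ.rank_le hD he (q := fun x => (q x).1) (fun x y hxy => hq x y hxy) x).trans_lt ?_
  gcongr
  exact (q x).2

end Digraph

/-! ### Hereditarily finite sets -/

namespace ZFSet

/-- The `n`-fold singleton of the empty set. -/
def iteratedSingleton (n : ℕ) : ZFSet.{u} :=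
  (fun x : ZFSet.{u} => {x})^[n] ∅

theorem iteratedSingleton_succ (n : ℕ) :
    iteratedSingleton.{u} (n + 1) = {iteratedSingleton n} :=
  Function.iterate_succ_apply' _ _ _

theorem rank_iteratedSingleton (n : ℕ) : rank (iteratedSingleton.{u} n) = n := by
  induction n with
  | zero => simp [iteratedSingleton]
  | succ n ih => simp [iteratedSingleton_succ, ih]

theorem iteratedSingleton_injective : Function.Injective iteratedSingleton.{u} := fun m n h => by
  simpa [rank_iteratedSingleton] using congrArg rank h

theorem isHereditarilyFinite_of_finite {x : ZFSet.{u}} (hx : {z | z ∈ x}.Finite)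
    (h : ∀ y ∈ x, y.IsHereditarilyFinite) : x.IsHereditarilyFinite :=
  hereditarily_iff.2 ⟨hx, h⟩

theorem isHereditarilyFinite_empty : (∅ : ZFSet.{u}).IsHereditarilyFinite :=
  isHereditarilyFinite_of_finite (by simp) (by simp)

theorem IsHereditarilyFinite.insert {x y : ZFSet.{u}} (hx : x.IsHereditarilyFinite)
    (hy : y.IsHereditarilyFinite) : (insert x y : ZFSet.{u}).IsHereditarilyFinite := by
  refine isHereditarilyFinite_of_finite ?_ ?_
  · refine (hy.self.insert x).subset fun z hz => ?_
    exact mem_insert_iff.1 hz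
  · rintro z hz
    obtain rfl | hz := mem_insert_iff.1 hz
    exacts [hx, hy.mem hz]

theorem IsHereditarilyFinite.singleton {x : ZFSet.{u}} (hx : x.IsHereditarilyFinite) :
    ({x} : ZFSet.{u}).IsHereditarilyFinite :=
  isHereditarilyFinite_of_finite (by simp) (by simpa using hx)

theorem isHereditarilyFinite_iteratedSingleton (n : ℕ) :
    (iteratedSingleton.{u} n).IsHereditarilyFinite := by
  induction n with
  | zero => exact isHereditarilyFinite_empty
  | succ n ih => exact iteratedSingleton_succ.{u} n ▸ ih.singleton

end ZFSet

theorem Digraph.IsModifiedCollapse.isHereditarilyFinite {G : Type v} [Small.{u} G] [Finite G]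
    {D : Digraph G} {e π : G → ZFSet.{u}} (h : D.IsModifiedCollapse e π)
    (hD : WellFounded D.Adj) (he : ∀ x, (e x).IsHereditarilyFinite) :
    (ZFSet.range π).IsHereditarilyFinite := by
  refine ZFSet.isHereditarilyFinite_of_finite ?_ ?_
  · exact (Set.finite_range π).subset fun z hz => ZFSet.mem_range.1 hz
  · simp only [ZFSet.mem_range, forall_exists_index, forall_apply_eq_imp_iff]
    intro x
    induction x using hD.induction with
    | _ x ih =>
      refine ZFSet.isHereditarilyFinite_of_finite ?_ ?_
      · refine ((Set.finite_range π).insert {∅, e x}).subset fun z hz => ?_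
        obtain ⟨y, -, rfl⟩ | rfl := h.mem_iff.1 hz
        exacts [.inr ⟨y, rfl⟩, .inl rfl]
      · intro z hz
        obtain ⟨y, hy, rfl⟩ | rfl := h.mem_iff.1 hz
        exacts [ih y hy, ZFSet.isHereditarilyFinite_empty.insert (he x).singleton]

/-! ### Realizations in the von Neumann hierarchy -/

namespace Digraph

variable {G : Type v} [Small.{u} G] {D : Digraph G}

theorem exists_isHereditarilyFinite [Finite G] (hD : WellFounded D.Adj) :
    ∃ A : ZFSet.{u}, A.IsHereditarilyFinite ∧ D.IsoToMem A := by
  obtain ⟨f, hf⟩ := Countable.exists_injective_nat G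
  obtain ⟨π, hπ, -⟩ := existsUnique_isModifiedCollapse hD fun x => ZFSet.iteratedSingleton.{u} (f x)
  exact ⟨ZFSet.range π,
    hπ.isHereditarilyFinite hD fun x => ZFSet.isHereditarilyFinite_iteratedSingleton _,
    hπ.isoToMem (ZFSet.iteratedSingleton_injective.comp hf)⟩

theorem exists_subset_vonNeumann_of_countable [Countable G] (hD : WellFounded D.Adj)
    {lam : Ordinal.{u}} (hq : D.IsGraded (Set.Iio lam)) :
    ∃ A : ZFSet.{u}, A ⊆ V_ (Ordinal.omega0 + lam) ∧ D.IsoToMem A := by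
  obtain ⟨f, hf⟩ := Countable.exists_injective_nat G
  refine exists_subset_vonNeumann hD (ZFSet.iteratedSingleton_injective.comp hf) (fun x => ?_) hq
  simp only [Function.comp_apply, ZFSet.rank_pair, ZFSet.rank_iteratedSingleton, ZFSet.rank_empty]
  simpa using Ordinal.natCast_lt_omega0 (f x + 1)

theorem exists_subset_vonNeumann_of_card_le (hD : WellFounded D.Adj)
    {lam β : Ordinal.{u}} (hq : D.IsGraded (Set.Iio lam))
    (hG : Cardinal.lift.{u + 1} (Cardinal.mk G) ≤ Cardinal.lift.{v} (Cardinal.mk (V_ β))) :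
    ∃ A : ZFSet.{u}, A ⊆ V_ (β + 2 + lam) ∧ D.IsoToMem A := by
  obtain ⟨f⟩ := Cardinal.lift_mk_le'.1 hG
  refine exists_subset_vonNeumann hD (e := fun x => (f x : ZFSet.{u}))
    (Subtype.val_injective.comp f.injective) (fun x => ?_) hq
  have hx : (f x : ZFSet.{u}).rank < β := ZFSet.mem_vonNeumann.1 (f x).2
  have h2 : β + 2 = Order.succ (Order.succ β) := by
    rw [← one_add_one_eq_two, ← add_assoc, Order.succ_eq_add_one, Order.succ_eq_add_one]
  rw [ZFSet.rank_pair, ZFSet.rank_empty, h2, Order.lt_succ_iff, max_le_iff, Order.succ_le_succ_iff,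
    Order.succ_le_succ_iff]
  exact ⟨zero_le, hx.le⟩

end Digraph

/-- An infinite `lam` absorbs every finite summand on its left. For `β ≥ ω`, absorbing `β` means `β
* ω ≤ lam`, and `β * ω ≤ β ^ 2`. -/
theorem Ordinal.add_two_add_eq_of_sq_le {β lam : Ordinal.{u}} (hlam : Ordinal.omega0 ≤ lam)
    (h : β ^ 2 ≤ lam) : β + 2 + lam = lam := by
  have h2 : 2 + lam = lam := Ordinal.natCast_add_of_omega0_le hlam 2
  rw [add_assoc, h2]
  obtain hβ | hβ := lt_or_ge β Ordinal.omega0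
  · obtain ⟨n, rfl⟩ := Ordinal.lt_omega0.1 hβ
    exact Ordinal.natCast_add_of_omega0_le hlam n
  · rw [Ordinal.add_eq_right_iff_mul_omega0_le]
    refine le_trans ?_ h
    rw [pow_two]
    gcongr

/-! ### Definability and the constructible hierarchy -/

namespace ZFSet

open FirstOrder FirstOrder.Language

theorem mem_definablePowerset {A X : ZFSet.{u}} : X ∈ A.definablePowerset ↔
    X ⊆ A ∧ (Set.univ : Set A).Definable₁ setTheoryLanguage {a : A | (a : ZFSet.{u}) ∈ X} := by
  rw [definablePowerset, mem_sep, mem_powerset]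

section Definability

variable {A : ZFSet.{u}} {α : Type}

/-- A point of `A`, as a constant of the language expanded by parameters. -/
def parameter {n : ℕ} (a : A) :
    setTheoryLanguage[[(Set.univ : Set A)]].Term (α ⊕ Fin n) :=
  (setTheoryLanguage.con (⟨a, Set.mem_univ a⟩ : (Set.univ : Set A))).term

/-- The atomic formula `s ∈ t`. -/
def memFormula {n : ℕ} (s t : setTheoryLanguage[[(Set.univ : Set A)]].Term (α ⊕ Fin n)) :
    setTheoryLanguage[[(Set.univ : Set A)]].BoundedFormula α n :=
  Relations.boundedFormula₂ (Sum.inl (SetTheoryRel.mem : setTheoryLanguage.Relations 2)) s t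

@[simp]
theorem realize_parameter {n : ℕ} (a : A) (v : α ⊕ Fin n → A) :
    (parameter a).realize v = a := by
  simp [parameter]

@[simp]
theorem realize_memFormula {n : ℕ}
    (s t : setTheoryLanguage[[(Set.univ : Set A)]].Term (α ⊕ Fin n)) (v : α → A)
    (xs : Fin n → A) : (memFormula s t).Realize v xs ↔
      ((s.realize (Sum.elim v xs) : A) : ZFSet.{u}) ∈ ((t.realize (Sum.elim v xs) : A) : ZFSet.{u}) := by
  refine BoundedFormula.realize_rel₂.trans ?_
  rfl

theorem definable₁_mem (b : A) : (Set.univ : Set A).Definable₁ setTheoryLanguage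
    {a : A | (a : ZFSet.{u}) ∈ (b : ZFSet.{u})} :=
  ⟨memFormula (Term.var (.inl 0)) (parameter b), by ext v; simp [Formula.Realize]⟩

theorem definable₁_contains (b : A) : (Set.univ : Set A).Definable₁ setTheoryLanguage
    {a : A | (b : ZFSet.{u}) ∈ (a : ZFSet.{u})} :=
  ⟨memFormula (parameter b) (Term.var (.inl 0)), by ext v; simp [Formula.Realize]⟩

theorem definable₁_exists_mem (b p F : A) : (Set.univ : Set A).Definable₁ setTheoryLanguage
    {a : A | ∃ t : A, (t : ZFSet.{u}) ∈ (a : ZFSet.{u}) ∧ (b : ZFSet.{u}) ∈ (t : ZFSet.{u}) ∧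
      ((p : ZFSet.{u}) ∈ (t : ZFSet.{u}) ∨ (t : ZFSet.{u}) ∈ (F : ZFSet.{u}))} :=
  ⟨BoundedFormula.ex (memFormula (Term.var (.inr 0)) (Term.var (.inl 0)) ⊓
    (memFormula (parameter b) (Term.var (.inr 0)) ⊓
      (memFormula (parameter p) (Term.var (.inr 0)) ⊔
        memFormula (Term.var (.inr 0)) (parameter F)))), by
    ext v
    simp only [Set.mem_ofPred_eq, Formula.Realize, BoundedFormula.realize_ex,
      BoundedFormula.realize_inf, BoundedFormula.realize_sup, realize_memFormula,
      realize_parameter, Term.realize_var, Sum.elim_inl, Sum.elim_inr]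
    rfl⟩

theorem definable₁_of_finite {s : Set A} (hs : s.Finite) :
    (Set.univ : Set A).Definable₁ setTheoryLanguage s := by
  induction s, hs using Set.Finite.induction_on with
  | empty => exact Set.definable_empty
  | @insert a s _ _ ih =>
    exact (Set.Definable.singleton_of_mem setTheoryLanguage (Set.mem_univ a)).union ih

end Definability

theorem mem_definablePowerset_of_finite {A X : ZFSet.{u}} (hX : {z | z ∈ X}.Finite)
    (h : X ⊆ A) : X ∈ A.definablePowerset :=
  mem_definablePowerset.2 ⟨h, definable₁_of_finite (hX.preimage Subtype.val_injective.injOn)⟩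

theorem IsTransitive.subset_definablePowerset {A : ZFSet.{u}} (hA : A.IsTransitive) :
    A ⊆ A.definablePowerset := fun x hx =>
  mem_definablePowerset.2 ⟨hA x hx, definable₁_mem ⟨x, hx⟩⟩

theorem IsTransitive.definablePowerset {A : ZFSet.{u}} (hA : A.IsTransitive) :
    A.definablePowerset.IsTransitive := fun _ hx _ hy =>
  hA.subset_definablePowerset ((mem_definablePowerset.1 hx).1 hy)

theorem isTransitive_constructible (o : Ordinal.{u}) : (constructible o).IsTransitive := by
  induction o using Ordinal.limitRecOn with
  | zero => rw [constructible_zero]; exact isTransitive_empty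
  | add_one o ih => rw [constructible_add_one]; exact ih.definablePowerset
  | limit o ho ih => rw [constructible_limit o ho]; exact .iUnion fun b => ih b.1 b.2

theorem constructible_subset_of_le {a b : Ordinal.{u}} (h : a ≤ b) :
    constructible a ⊆ constructible b := by
  induction b using Ordinal.limitRecOn with
  | zero => rw [nonpos_iff_eq_zero.1 h]
  | add_one o ih =>
    obtain rfl | h := h.eq_or_lt
    · exact fun _ h => h
    · rw [constructible_add_one]
      exact fun x hx => (isTransitive_constructible o).subset_definablePowerset
        (ih (Order.lt_add_one_iff.1 h) hx)
  | limit o ho ih =>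
    obtain rfl | h := h.eq_or_lt
    · exact fun _ h => h
    · rw [constructible_limit o ho]
      exact fun x hx => mem_iUnion.2 ⟨⟨a, h⟩, hx⟩

/-- Finitely many elements of `L_ω` already lie in a single `L_n`, and a finite subset of `L_n` is
definable with its elements as parameters. -/
theorem mem_constructible_omega0_of_finite {X : ZFSet.{u}} (hX : {z | z ∈ X}.Finite)
    (h : ∀ z ∈ X, z ∈ constructible Ordinal.omega0) : X ∈ constructible Ordinal.omega0 := by
  have key (z : ZFSet.{u}) :
      z ∈ constructible Ordinal.omega0 ↔ ∃ n : ℕ, z ∈ constructible (n : Ordinal.{u}) := by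
    rw [constructible_limit _ Ordinal.isSuccLimit_omega0, mem_iUnion]
    constructor
    · rintro ⟨⟨b, hb⟩, hz⟩
      obtain ⟨n, rfl⟩ := Ordinal.lt_omega0.1 hb
      exact ⟨n, hz⟩
    · rintro ⟨n, hz⟩
      exact ⟨⟨n, Ordinal.natCast_lt_omega0 n⟩, hz⟩
  have hsup : ∃ n : ℕ, ∀ z ∈ X, z ∈ constructible (n : Ordinal.{u}) := by
    choose! k hk using fun z hz => (key z).1 (h z hz)
    obtain ⟨n, hn⟩ := (hX.image k).bddAbove
    exact ⟨n, fun z hz => constructible_subset_of_le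
      (Nat.cast_le.2 (hn (Set.mem_image_of_mem k hz))) (hk z hz)⟩
  obtain ⟨n, hn⟩ := hsup
  refine (key X).2 ⟨n + 1, ?_⟩
  rw [Nat.cast_add_one, constructible_add_one]
  exact mem_definablePowerset_of_finite hX hn

theorem iteratedSingleton_mem_constructible_omega0 (n : ℕ) :
    iteratedSingleton.{u} n ∈ constructible Ordinal.omega0 := by
  induction n with
  | zero => apply mem_constructible_omega0_of_finite <;> simp [iteratedSingleton]
  | succ n ih =>
    rw [iteratedSingleton_succ]
    exact mem_constructible_omega0_of_finite (by simp) (by simpa using ih)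

/-- The members `z` of `A` with `∅ ∉ z` that have a member `t` with `∅ ∈ t` such that `p ∈ t` or
`t ∈ F`, together with `s`. -/
noncomputable def tagged (A p F s : ZFSet.{u}) : ZFSet.{u} :=
  insert s (ZFSet.sep (fun z => ∅ ∉ z ∧ ∃ t ∈ z, ∅ ∈ t ∧ (p ∈ t ∨ t ∈ F)) A)

theorem mem_tagged {A p F s z : ZFSet.{u}} : z ∈ tagged A p F s ↔
    z = s ∨ z ∈ A ∧ ∅ ∉ z ∧ ∃ t ∈ z, ∅ ∈ t ∧ (p ∈ t ∨ t ∈ F) := by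
  rw [tagged, mem_insert_iff, mem_sep]

theorem tagged_mem_definablePowerset {A p F s : ZFSet.{u}} (hA : A.IsTransitive) (h0 : ∅ ∈ A)
    (hp : p ∈ A) (hF : F ∈ A) (hs : s ∈ A) : tagged A p F s ∈ A.definablePowerset := by
  refine mem_definablePowerset.2 ⟨fun z hz => ?_, ?_⟩
  · obtain rfl | hz := mem_tagged.1 hz
    exacts [hs, hz.1]
  · have := (Set.Definable.singleton_of_mem setTheoryLanguage (Set.mem_univ (⟨s, hs⟩ : A))).union
      ((definable₁_contains ⟨∅, h0⟩).compl.inter (definable₁_exists_mem ⟨∅, h0⟩ ⟨p, hp⟩ ⟨F, hF⟩))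
    unfold Set.Definable₁
    convert this using 1
    ext v
    simp only [Set.mem_ofPred_eq, mem_tagged, Set.mem_union, Set.mem_inter_iff, Set.mem_compl_iff,
      Subtype.ext_iff, Set.mem_singleton_iff]
    -- Transitivity puts the witness `t ∈ z` into `A`, so quantifying over `A` loses nothing.
    refine or_congr Iff.rfl ⟨fun ⟨_, h1, t, ht, h2⟩ => ⟨h1, ⟨t, hA.mem_trans ht (v 0).2⟩, ht, h2⟩,
      fun ⟨h1, t, ht⟩ => ⟨(v 0).2, h1, t, ht⟩⟩

end ZFSet

/-! ### Coding a countable graded digraph in the constructible hierarchy -/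

namespace Digraph

theorem finite_subtype_lt {G : Type v} {f : G → ℕ} (hf : Function.Injective f) (x : G) (p : G → Prop) :
    Finite {y : G // f y < f x ∧ p y} :=
  Finite.of_injective (fun y => (⟨f y, y.2.1⟩ : Set.Iio (f x)))
    fun _ _ h => Subtype.ext (hf (congrArg Subtype.val h))

variable {G : Type v} [Small.{u} G] (D : Digraph G) (f : G → ℕ)

/-- The tag of a vertex `x`, recording which earlier vertices `x` points to. -/
noncomputable def tag (x : G) : ZFSet.{u} :=
  insert ∅ (insert (ZFSet.iteratedSingleton (f x + 1)) (ZFSet.range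
    fun y : {y : G // f y < f x ∧ D.Adj x y} => ZFSet.iteratedSingleton (f y + 1)))

/-- The set of the tags of the earlier vertices that point to `x`. -/
noncomputable def earlierTags (x : G) : ZFSet.{u} :=
  ZFSet.range fun y : {y : G // f y < f x ∧ D.Adj y x} => D.tag f y

/-- The set representing a vertex `x` at level `ω + q x` of the constructible hierarchy. -/
noncomputable def constructibleNode (q : G → Ordinal.{u}) (x : G) : ZFSet.{u} :=
  ZFSet.tagged (ZFSet.constructible (Ordinal.omega0 + q x))
    (ZFSet.iteratedSingleton (f x + 1)) (D.earlierTags f x) (D.tag f x)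

variable {D f} {q : G → Ordinal.{u}}

theorem empty_mem_tag (x : G) : ∅ ∈ D.tag f x :=
  ZFSet.mem_insert _ _

theorem iteratedSingleton_mem_tag (hf : Function.Injective f) {x y : G} :
    ZFSet.iteratedSingleton.{u} (f y + 1) ∈ D.tag f x ↔ y = x ∨ f y < f x ∧ D.Adj x y := by
  -- The shift by one keeps vertex codes apart from `∅`, which lies in every tag.
  have h0 : ZFSet.iteratedSingleton.{u} (f y + 1) ≠ ∅ := fun h =>
    absurd (ZFSet.iteratedSingleton_injective (a₂ := 0) h) (by simp)
  simp only [tag, ZFSet.mem_insert_iff, h0, false_or, ZFSet.mem_range,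
    ZFSet.iteratedSingleton_injective.eq_iff, add_left_inj, hf.eq_iff]
  refine or_congr Iff.rfl ⟨?_, fun h => ⟨⟨y, h⟩, rfl⟩⟩
  rintro ⟨z, rfl⟩
  exact z.2

/-- A tag contains its own vertex code and otherwise only codes of earlier vertices; two distinct
vertices with equal tags would each precede the other. -/
theorem tag_injective (hf : Function.Injective f) : Function.Injective (D.tag.{u} f) := by
  intro x y h
  have hx := (iteratedSingleton_mem_tag (D := D) hf).1 (h ▸
    (iteratedSingleton_mem_tag hf).2 (.inl rfl) : ZFSet.iteratedSingleton.{u} (f x + 1) ∈ D.tag f y)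
  have hy := (iteratedSingleton_mem_tag (D := D) hf).1 (h ▸
    (iteratedSingleton_mem_tag hf).2 (.inl rfl) : ZFSet.iteratedSingleton.{u} (f y + 1) ∈ D.tag f x)
  obtain rfl | hx := hx
  · rfl
  · obtain rfl | hy := hy
    · rfl
    · exact (hx.1.asymm hy.1).elim

theorem tag_mem_earlierTags (hf : Function.Injective f) {x y : G} :
    D.tag f y ∈ D.earlierTags.{u} f x ↔ f y < f x ∧ D.Adj y x := by
  simp only [earlierTags, ZFSet.mem_range, (tag_injective hf).eq_iff]
  refine ⟨?_, fun h => ⟨⟨y, h⟩, rfl⟩⟩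
  rintro ⟨z, rfl⟩
  exact z.2

theorem tag_mem_constructible (hf : Function.Injective f) (x : G) :
    D.tag f x ∈ ZFSet.constructible.{u} Ordinal.omega0 := by
  have := finite_subtype_lt hf x (D.Adj x)
  apply ZFSet.mem_constructible_omega0_of_finite
  · refine (((Set.finite_range fun y : {y : G // f y < f x ∧ D.Adj x y} =>
      ZFSet.iteratedSingleton.{u} (f y + 1)).insert
        (ZFSet.iteratedSingleton (f x + 1))).insert ∅).subset fun z hz => ?_
    simpa [tag, Set.insert_def] using hz
  · intro z hz
    simp only [tag, ZFSet.mem_insert_iff, ZFSet.mem_range] at hz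
    obtain rfl | rfl | ⟨y, rfl⟩ := hz
    · exact ZFSet.iteratedSingleton_mem_constructible_omega0 0
    all_goals exact ZFSet.iteratedSingleton_mem_constructible_omega0 _

theorem earlierTags_mem_constructible (hf : Function.Injective f) (x : G) :
    D.earlierTags f x ∈ ZFSet.constructible.{u} Ordinal.omega0 := by
  have := finite_subtype_lt hf x (D.Adj · x)
  apply ZFSet.mem_constructible_omega0_of_finite
  · exact (Set.finite_range fun y : {y : G // f y < f x ∧ D.Adj y x} =>
      D.tag.{u} f y).subset fun z hz => ZFSet.mem_range.1 hz
  · intro z hz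
    obtain ⟨y, rfl⟩ := ZFSet.mem_range.1 hz
    exact tag_mem_constructible hf _

theorem constructibleNode_mem (hf : Function.Injective f) (x : G) :
    D.constructibleNode f q x ∈ ZFSet.constructible (Ordinal.omega0 + q x + 1) := by
  have h {z : ZFSet.{u}} (hz : z ∈ ZFSet.constructible Ordinal.omega0) :
      z ∈ ZFSet.constructible (Ordinal.omega0 + q x) :=
    ZFSet.constructible_subset_of_le le_self_add hz
  rw [ZFSet.constructible_add_one]
  exact ZFSet.tagged_mem_definablePowerset (ZFSet.isTransitive_constructible _)
    (h (ZFSet.iteratedSingleton_mem_constructible_omega0 0))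
    (h (ZFSet.iteratedSingleton_mem_constructible_omega0 _))
    (h (earlierTags_mem_constructible hf x)) (h (tag_mem_constructible hf x))

/-- This makes the tag recoverable from the node: the defining formula of `ZFSet.tagged` rejects
every candidate containing `∅`. -/
theorem mem_constructibleNode_iff_of_empty_mem {t : ZFSet.{u}} (ht : ∅ ∈ t) (x : G) :
    t ∈ D.constructibleNode f q x ↔ t = D.tag f x := by
  rw [constructibleNode, ZFSet.mem_tagged]
  exact or_iff_left fun h => h.2.1 ht

theorem empty_notMem_constructibleNode (x : G) : ∅ ∉ D.constructibleNode f q x := by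
  rw [constructibleNode, ZFSet.mem_tagged]
  rintro (h | ⟨-, -, t, ht, -⟩)
  · exact (ZFSet.eq_empty _).1 h.symm ∅ (empty_mem_tag x)
  · exact ZFSet.notMem_empty t ht

theorem constructibleNode_injective (hf : Function.Injective f) :
    Function.Injective (D.constructibleNode f q) := fun x y h =>
  tag_injective hf <| (mem_constructibleNode_iff_of_empty_mem (q := q) (empty_mem_tag x) y).1 <|
    h ▸ (mem_constructibleNode_iff_of_empty_mem (empty_mem_tag x) x).2 rfl

theorem constructibleNode_mem_iff (hf : Function.Injective f)
    (hq : ∀ x y, D.Adj x y → q x < q y) (x y : G) :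
    D.constructibleNode f q y ∈ D.constructibleNode f q x ↔ D.Adj y x := by
  by_cases hxy : x = y
  · subst hxy
    exact iff_of_false (ZFSet.mem_irrefl _) fun h => (hq x x h).false
  have htag : (∃ t ∈ D.constructibleNode f q y, ∅ ∈ t ∧
      (ZFSet.iteratedSingleton (f x + 1) ∈ t ∨ t ∈ D.earlierTags f x)) ↔ D.Adj y x := by
    have : (ZFSet.iteratedSingleton.{u} (f x + 1) ∈ D.tag f y ∨ D.tag f y ∈ D.earlierTags.{u} f x) ↔
        D.Adj y x := by
      rw [iteratedSingleton_mem_tag hf, tag_mem_earlierTags hf]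
      -- If `y` is later, its tag records the edge `y → x`; if `x` is later, `earlierTags` of `x`
      -- does.
      have := lt_or_gt_of_ne (hf.ne hxy)
      tauto
    rw [← this]
    constructor
    · rintro ⟨t, ht, h0, h⟩
      rwa [(mem_constructibleNode_iff_of_empty_mem h0 y).1 ht] at h
    · exact fun h => ⟨_, (mem_constructibleNode_iff_of_empty_mem (empty_mem_tag y) y).2 rfl,
        empty_mem_tag y, h⟩
  rw [constructibleNode.eq_1 D f q x, ZFSet.mem_tagged, htag, or_iff_right]
  · refine ⟨fun h => h.2.2, fun h => ⟨?_, empty_notMem_constructibleNode y, h⟩⟩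
    -- The node of `y` appears one level above `ω + q y`, which is still within `ω + q x` because `q
    -- y < q x`.
    refine ZFSet.constructible_subset_of_le ?_ (constructibleNode_mem hf y)
    rw [add_assoc]
    gcongr
    exact Order.add_one_le_of_lt (hq y x h)
  · exact fun h => empty_notMem_constructibleNode y (h ▸ empty_mem_tag x)

theorem exists_subset_constructible [Countable G] {lam : Ordinal.{u}}
    (hq : D.IsGraded (Set.Iio lam)) :
    ∃ A : ZFSet.{u}, A ⊆ ZFSet.constructible (Ordinal.omega0 + lam) ∧ D.IsoToMem A := by
  obtain ⟨f, hf⟩ := Countable.exists_injective_nat G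
  obtain ⟨q, hq⟩ := hq
  refine ⟨_, fun z hz => ?_, isoToMem_range (constructibleNode_injective hf) fun x y =>
    constructibleNode_mem_iff hf (q := fun x => (q x).1) (fun x y h => hq x y h) y x⟩
  obtain ⟨x, rfl⟩ := ZFSet.mem_range.1 hz
  refine ZFSet.constructible_subset_of_le ?_ (constructibleNode_mem hf x)
  rw [add_assoc]
  gcongr
  exact Order.add_one_le_of_lt (q x).2

end Digraph

theorem mainTheorem9 {G : Type v} [Small.{u} G] (D : Digraph G) (hD : WellFounded D.Adj) :
    -- every well-founded digraph is isomorphic to some `(A, ∈)`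
    (∃ A : ZFSet.{u}, D.IsoToMem A) ∧
    -- via the modified Mostowski collapse, whichever distinct sets the nodes are
    (∀ e : G → ZFSet.{u}, Function.Injective e →
      (∃! π : G → ZFSet.{u}, D.IsModifiedCollapse e π) ∧
      ∀ π : G → ZFSet.{u}, D.IsModifiedCollapse e π →
        ∃ φ : D.Adj ≃r (fun a b : ZFSet.range π => (a : ZFSet.{u}) ∈ (b : ZFSet.{u})),
          ∀ x : G, (φ x : ZFSet.{u}) = π x) ∧
    -- (1)
    (Finite G → ∃ A : ZFSet.{u}, A.IsHereditarilyFinite ∧ D.IsoToMem A) ∧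
    -- (2)
    (∀ lam : Ordinal.{u}, Countable G → D.IsGraded (Set.Iio lam) →
      (∃ A : ZFSet.{u}, A ⊆ V_ (Ordinal.omega0 + lam) ∧ D.IsoToMem A) ∧
      (Ordinal.omega0 ^ 2 ≤ lam → ∃ A : ZFSet.{u}, A ⊆ V_ lam ∧ D.IsoToMem A)) ∧
    -- (3)
    (∀ lam β : Ordinal.{u}, D.IsGraded (Set.Iio lam) →
      Cardinal.lift.{u + 1} (Cardinal.mk G) ≤ Cardinal.lift.{v} (Cardinal.mk (V_ β)) →
      (∃ A : ZFSet.{u}, A ⊆ V_ (β + 2 + lam) ∧ D.IsoToMem A) ∧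
      (Ordinal.omega0 ≤ lam → β ^ 2 ≤ lam → ∃ A : ZFSet.{u}, A ⊆ V_ lam ∧ D.IsoToMem A)) ∧
    -- (4)
    (∀ lam : Ordinal.{u}, Ordinal.omega0 ≤ lam → Countable G → D.IsGraded (Set.Iio lam) →
      ∃ A : ZFSet.{u}, A ⊆ ZFSet.constructible (lam + lam) ∧ D.IsoToMem A) := by
  have hcollapse (e : G → ZFSet.{u}) := Digraph.existsUnique_isModifiedCollapse hD e
  have hV {κ lam : Ordinal.{u}} (h : κ + lam = lam)
      (hA : ∃ A : ZFSet.{u}, A ⊆ V_ (κ + lam) ∧ D.IsoToMem A) :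
      ∃ A : ZFSet.{u}, A ⊆ V_ lam ∧ D.IsoToMem A := h ▸ hA
  refine ⟨?_, fun e he => ⟨hcollapse e, fun π hπ =>
      Digraph.exists_relIso_range (hπ.injective he) (hπ.mem_iff_adj he)⟩,
    fun _ => Digraph.exists_isHereditarilyFinite hD, fun lam _ hq => ?_, fun lam β hq hG => ?_,
    fun lam hlam _ hq => ?_⟩
  · let e : G → ZFSet.{u} := fun x => (Ordinal.typein WellOrderingRel (equivShrink.{u} G x)).toZFSet
    have he : Function.Injective e := Ordinal.toZFSet_injective.comp
      ((Ordinal.typein_injective _).comp (equivShrink G).injective)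
    obtain ⟨π, hπ, -⟩ := hcollapse e
    exact ⟨_, hπ.isoToMem he⟩
  · have hA := Digraph.exists_subset_vonNeumann_of_countable hD hq
    refine ⟨hA, fun h => hV ?_ hA⟩
    rwa [Ordinal.add_eq_right_iff_mul_omega0_le, ← pow_two]
  · have hA := Digraph.exists_subset_vonNeumann_of_card_le hD hq hG
    exact ⟨hA, fun hlam h => hV (Ordinal.add_two_add_eq_of_sq_le hlam h) hA⟩
  · obtain ⟨A, hA, hiso⟩ := Digraph.exists_subset_constructible hq
    -- The construction reaches only `ω + lam`, which is at most `lam + lam` for infinite `lam`.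
    exact ⟨A, fun z hz => ZFSet.constructible_subset_of_le (by gcongr) (hA hz), hiso⟩
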